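/- A network is a finite simple graph $N=(V,E)$, and a clustering of $N$ is a partition of $V$ into nonempty clusters. For a cluster $c$ let $e_c$ be the number of edges with both endpoints in $c$ and $d_c$ the sum of the degrees in $N$ of the vertices of $c$. The modularity of a clustering $\mathcal C$ is $$\mathcal H(\mathcal C)=\sum_{c\in\mathcal C}\left[\frac{e_c}{|E|}-\left(\frac{d_c}{2|E|}\right)^2\right]$$ (read as $0$ if $E=\emptyset$). A clustering is *optimal* for $N$ if each of its clusters induces a connected subgraph and it has the largest modularity among all clusterings of $N$ with this property. A *modularity method* $M$ assigns to every network $N$ an optimal clustering $M(N)$; ties are broken arbitrarily. **Theorem.** Every modularity method $M$ satisfies - **Richness**: for every clustering $\Gamma$ of a finite set $V$ there is an edge set $E$ with $M((V,E))=\Gamma$; and violates each of the following axioms. - **Standard Consistency**: if $N'$ arises from $N$ by removing edges between clusters of $M(N)$ and adding edges within clusters of $M(N)$, then $M(N')=M(N)$. - **Refinement Consistency**: for $N,N'$ as in Standard Consistency, every cluster of $M(N')$ is contained in a cluster of $M(N)$, and every cluster of $M(N)$ that has received no new internal edge is also a cluster of $M(N')$. (The weaker, Kleinberg form, which demands only that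 every cluster of $M(N')$ be contained in a cluster of $M(N)$, is violated as well.) - **Inter-edge Consistency**: if $N'$ arises from $N$ by removing edges between clusters of $M(N)$, then $M(N')=M(N)$. - **Connectivity**: there is a nondecreasing $f:\mathbb R_{\ge 0}\to\mathbb R_{\ge 0}$ with $f(x)\to\infty$ as $x\to\infty$ such that, for every network $N$ and every cluster $c$ of $M(N)$ with $n\ge 2$ vertices, the minimum edge cut of the subgraph induced on $c$ has size greater than $f(n)$. - **Pair-of-Cliques**: there is a constant $n_0$ such that, whenever $A$ and $B$ are disjoint cliques of the same size in a network $N$, joined by exactly one edge, with no edge of $N$ leaving $A\cup B$, and $|A\cup B|\ge n_0$, both $A$ and $B$ are clusters of $M(N)$. - **Fixed Point**: for every network $N$ and every set $\mathcal D\subseteq M(N)$ of output clusters, $M$ applied to the subgraph of $N$ induced on $\bigcup\mathcal D$ returns $\mathcal D$. Moreover, modularity is not resolution-limit-free as an objective function: it is not true that, for every network $N$, every optimal clustering $\mathcal C$ of $N$ and every $\mathcal D\subseteq\mathcal C$, the clustering $\mathcal D$ is optimal for the subgraph of $N$ induced on $\bigcup\mathcal D$. -/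

import Mathlib

open Filter
open scoped NNReal

universe u

namespace GraphClustering

/-- A clustering of the vertex set `V`: a partition of `V` into nonempty, pairwise disjoint
clusters. -/
abbrev Clustering (V : Type u) [Fintype V] [DecidableEq V] : Type u :=
  Finpartition (Finset.univ : Finset V)

/-- A clustering method assigns to every network (finite simple graph) a clustering of its
vertex set. -/
abbrev ClusteringMethod : Type (u + 1) :=
  ∀ (V : Type u) [Fintype V] [DecidableEq V], SimpleGraph V → Clustering V

section Modularity

variable {V : Type u} [Fintype V] [DecidableEq V]

/-- The number of edges of `G`. -/
noncomputable def numEdges (G : SimpleGraph V) : ℕ :=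
  G.edgeSet.ncard

/-- `e_c`: the number of edges of `G` with both endpoints in `c`. -/
noncomputable def internalEdges (G : SimpleGraph V) (c : Finset V) : ℕ :=
  {e ∈ G.edgeSet | ∀ v ∈ e, v ∈ c}.ncard

open Classical in
/-- `d_c`: the sum over the vertices of `c` of their degrees in the whole network `G`. -/
noncomputable def degreeSum (G : SimpleGraph V) (c : Finset V) : ℕ :=
  ∑ v ∈ c, G.degree v

/-- The modularity score of a clustering. (If `G` has no edges all scores are `0`; then the only
clustering with connected clusters is the one into singletons.) -/
noncomputable def modularity (G : SimpleGraph V) (P : Clustering V) : ℝ :=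
  ∑ c ∈ P.parts, ((internalEdges G c : ℝ) / numEdges G
    - ((degreeSum G c : ℝ) / (2 * numEdges G)) ^ 2)

/-- Every cluster induces a connected subgraph. -/
def HasConnectedClusters (G : SimpleGraph V) (P : Clustering V) : Prop :=
  ∀ c ∈ P.parts, (G.induce (c : Set V)).Connected

/-- `P` is an optimal solution of the modularity optimisation problem with connected clusters. -/
def IsModularityOptimal (G : SimpleGraph V) (P : Clustering V) : Prop :=
  HasConnectedClusters G P ∧
    ∀ Q : Clustering V, HasConnectedClusters G Q → modularity G Q ≤ modularity G P

/-- `u` and `v` lie in a common cluster of `P`. -/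
def SameCluster (P : Clustering V) (u v : V) : Prop :=
  ∃ c ∈ P.parts, u ∈ c ∧ v ∈ c

/-- `H` arises from `G` by removing edges between clusters of `P` and adding edges within clusters
of `P`. -/
def IsConsistentChange (P : Clustering V) (G H : SimpleGraph V) : Prop :=
  ∀ u v : V, (SameCluster P u v → G.Adj u v → H.Adj u v) ∧
    (¬ SameCluster P u v → H.Adj u v → G.Adj u v)

/-- `H` arises from `G` by removing edges between clusters of `P`. -/
def IsInterEdgeRemoval (P : Clustering V) (G H : SimpleGraph V) : Prop :=
  H ≤ G ∧ ∀ u v : V, SameCluster P u v → G.Adj u v → H.Adj u v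

open Classical in
/-- The number of edges of `G` between the disjoint vertex sets `S` and `T`. -/
noncomputable def cutSize (G : SimpleGraph V) (S T : Finset V) : ℕ :=
  (G.interedges S T).card

/-- The size of a minimum edge cut of the subgraph of `G` induced on `c` (for `c` with at least
two vertices). -/
noncomputable def minEdgeCut (G : SimpleGraph V) (c : Finset V) : ℕ :=
  sInf {k : ℕ | ∃ S ⊂ c, S.Nonempty ∧ k = cutSize G S (c \ S)}

/-- `A ∪ B` is a Pair-of-Cliques component of `G`: `A` and `B` are disjoint cliques of the same
size, joined by exactly one edge, and no edge of `G` leaves `A ∪ B`. -/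
structure IsPairOfCliquesComponent (G : SimpleGraph V) (A B : Finset V) : Prop where
  disjoint : Disjoint A B
  card_eq : A.card = B.card
  clique_left : G.IsClique (A : Set V)
  clique_right : G.IsClique (B : Set V)
  one_edge : cutSize G A B = 1
  closed : ∀ u ∈ A ∪ B, ∀ v : V, G.Adj u v → v ∈ A ∪ B

end Modularity

/-- `M` solves the modularity optimisation problem with connected clusters exactly; ties between
optimal clusterings are broken arbitrarily. -/
def IsModularityOptimisation (M : ClusteringMethod.{u}) : Prop :=
  ∀ (V : Type u) [Fintype V] [DecidableEq V] (G : SimpleGraph V), IsModularityOptimal G (M V G)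

/-- Every clustering of every finite set is the output on some network on that set. -/
def Richness (M : ClusteringMethod.{u}) : Prop :=
  ∀ (V : Type u) [Fintype V] [DecidableEq V] (P : Clustering V),
    ∃ G : SimpleGraph V, M V G = P

def StandardConsistency (M : ClusteringMethod.{u}) : Prop :=
  ∀ (V : Type u) [Fintype V] [DecidableEq V] (G H : SimpleGraph V),
    IsConsistentChange (M V G) G H → M V H = M V G

/-- Clusters that receive new internal edges may be split; nothing else may change. Here `≤` is
the refinement order on partitions. -/
def RefinementConsistency (M : ClusteringMethod.{u}) : Prop :=
  ∀ (V : Type u) [Fintype V] [DecidableEq V] (G H : SimpleGraph V),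
    IsConsistentChange (M V G) G H →
      M V H ≤ M V G ∧
        ∀ c ∈ (M V G).parts, (∀ u ∈ c, ∀ v ∈ c, H.Adj u v → G.Adj u v) → c ∈ (M V H).parts

/-- The weaker form of refinement consistency that goes back to Kleinberg: it is only required that
every new cluster is contained in an old one. -/
def KleinbergRefinementConsistency (M : ClusteringMethod.{u}) : Prop :=
  ∀ (V : Type u) [Fintype V] [DecidableEq V] (G H : SimpleGraph V),
    IsConsistentChange (M V G) G H → M V H ≤ M V G

def InterEdgeConsistency (M : ClusteringMethod.{u}) : Prop :=
  ∀ (V : Type u) [Fintype V] [DecidableEq V] (G H : SimpleGraph V),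
    IsInterEdgeRemoval (M V G) G H → M V H = M V G

/-- For some nondecreasing `f` tending to infinity, in every non-singleton output cluster with `n`
vertices the minimum edge cut has size greater than `f n`. -/
def Connectivity (M : ClusteringMethod.{u}) : Prop :=
  ∃ f : ℝ≥0 → ℝ≥0, Monotone f ∧ Tendsto f atTop atTop ∧
    ∀ (V : Type u) [Fintype V] [DecidableEq V] (G : SimpleGraph V),
      ∀ c ∈ (M V G).parts, 2 ≤ c.card → f (c.card : ℝ≥0) < (minEdgeCut G c : ℝ≥0)

/-- The two cliques of every sufficiently large Pair-of-Cliques component are output clusters. -/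
def PairOfCliques (M : ClusteringMethod.{u}) : Prop :=
  ∃ n₀ : ℕ, ∀ (V : Type u) [Fintype V] [DecidableEq V] (G : SimpleGraph V) (A B : Finset V),
    IsPairOfCliquesComponent G A B → n₀ ≤ (A ∪ B).card →
      A ∈ (M V G).parts ∧ B ∈ (M V G).parts

section FixedPoint

variable {V : Type u} [Fintype V] [DecidableEq V]

/-- The subnetwork of `G` induced on the union of the vertex sets in `D`. -/
abbrev inducedOnUnion (G : SimpleGraph V) (D : Finset (Finset V)) :
    SimpleGraph {v : V // v ∈ D.sup id} :=
  G.comap Subtype.val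

/-- The clusters of a clustering of a subset of `V`, regarded as subsets of `V`. -/
def clustersIn {W : Finset V} (Q : Clustering {v : V // v ∈ W}) : Finset (Finset V) :=
  Q.parts.image (fun c => c.image Subtype.val)

end FixedPoint

/-- Applied to the subnetwork induced on any set of its output clusters, the method returns exactly
these clusters. -/
def FixedPoint (M : ClusteringMethod.{u}) : Prop :=
  ∀ (V : Type u) [Fintype V] [DecidableEq V] (G : SimpleGraph V) (D : Finset (Finset V)),
    D ⊆ (M V G).parts → clustersIn (M {v : V // v ∈ D.sup id} (inducedOnUnion G D)) = D

/-- The same property for the objective function: any set of clusters of an optimal clustering is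
an optimal clustering of the subnetwork induced on it. -/
def ModularityResolutionLimitFree : Prop :=
  ∀ (V : Type u) [Fintype V] [DecidableEq V] (G : SimpleGraph V) (P : Clustering V),
    IsModularityOptimal G P → ∀ D ⊆ P.parts, ∀ Q : Clustering {v : V // v ∈ D.sup id},
      clustersIn Q = D → IsModularityOptimal (inducedOnUnion G D) Q

/-- Modularity optimisation with connected clusters always has a solution. -/
theorem exists_isModularityOptimisation :
    ∃ M : ClusteringMethod.{u}, IsModularityOptimisation M := by
  have key : ∀ (V : Type u) [Fintype V] [DecidableEq V] (G : SimpleGraph V),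
      ∃ P : Clustering V, IsModularityOptimal G P := by
    intro V _ _ G
    have hne : {P : Clustering V | HasConnectedClusters G P}.Nonempty := by
      refine ⟨⊥, fun c hc => ?_⟩
      rw [Finpartition.mem_bot_iff] at hc
      obtain ⟨a, -, rfl⟩ := hc
      rw [Finset.coe_singleton]
      exact SimpleGraph.Connected.of_subsingleton
    obtain ⟨P, hP, hmax⟩ := Set.exists_max_image _ (modularity G)
      (Set.toFinite {P : Clustering V | HasConnectedClusters G P}) hne
    exact ⟨P, hP, fun Q hQ => hmax Q hQ⟩
  choose F hF using key
  exact ⟨fun V _ _ G => F V G, fun V _ _ G => hF V G⟩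

end GraphClustering

/-!
Everything rests on two exchange arguments for an optimal clustering of a network with `m` edges.
Replacing two clusters `a`, `b` by their union changes the modularity by
`e(a, b) / m - 2 d_a d_b / (2m)²`, where `e(a, b)` is the number of edges between them. Hence
`2m e(a, b) ≤ d_a d_b` for adjacent clusters (`IsModularityOptimal.le_of_adj`), and
`d_a d_b ≤ 2m e(a, b)` whenever a cluster is the disjoint union of two connected pieces `a`, `b`
(`IsModularityOptimal.le_of_union_mem`). Since `d_a d_b` is local and `m` is global, whether a fixed
component is split depends on the rest of the network; this is the resolution limit, and it breaks
the axioms.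

A vertex of degree one always lies in the cluster of its neighbour
(`IsModularityOptimal.part_eq_of_leaf`). So a component that is a double star, two stars with `p`
and `q` vertices joined by an edge between their centres, is either one cluster or split into the
two stars, and the exchange arguments decide which: it is one cluster if `(2p - 1)(2q - 1) < 2m`
and split if `(2p - 1)(2q - 1) > 2m` (`IsDoubleStar.part_eq_of_lt`, `IsDoubleStar.part_ne_of_lt`).
As these inequalities are strict, the way in which ties are broken plays no role.

* Kleinberg's refinement consistency, hence also standard and refinement consistency: adding an
  edge inside another cluster increases `m` and merges the halves of a double star.
* Inter-edge consistency: removing an edge between two clusters decreases `m` and splits a double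
  star elsewhere.
* Fixed point and resolution-limit-freeness: in two disjoint paths with four vertices each path is a
  cluster, but a single such path is split.
* Connectivity: a star is a single cluster, with a minimum edge cut of size `1`.
* Pair-of-cliques: in a disjoint union of many pairs of cliques, `m` is too large for the two
  cliques of a pair to be separate clusters.
* Richness: a disjoint union of cliques is clustered into these cliques, since merging two parts of
  a clique always pays.
-/

namespace GraphClustering

/-! ### Counting edges and degrees -/

section Counting

variable {V : Type u} [Fintype V] [DecidableEq V] (G : SimpleGraph V)

open Classical in
omit [Fintype V] [DecidableEq V] in
lemma cutSize_eq_sum (S T : Finset V) :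
    cutSize G S T = ∑ u ∈ S, ∑ v ∈ T, if G.Adj u v then 1 else 0 := by
  rw [← Finset.sum_product' S T (fun u v => if G.Adj u v then 1 else 0), ← Finset.card_filter]
  rfl

omit [Fintype V] [DecidableEq V] in
lemma cutSize_comm (S T : Finset V) : cutSize G S T = cutSize G T S := by
  classical
  simp only [cutSize_eq_sum]
  rw [Finset.sum_comm]
  simp only [G.adj_comm]

omit [Fintype V] in
lemma cutSize_union_left {S T : Finset V} (h : Disjoint S T) (U : Finset V) :
    cutSize G (S ∪ T) U = cutSize G S U + cutSize G T U := by
  classical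
  simp only [cutSize_eq_sum, Finset.sum_union h]

omit [Fintype V] in
lemma cutSize_union_right (U : Finset V) {S T : Finset V} (h : Disjoint S T) :
    cutSize G U (S ∪ T) = cutSize G U S + cutSize G U T := by
  rw [cutSize_comm, cutSize_union_left G h, cutSize_comm G S, cutSize_comm G T]

omit [Fintype V] [DecidableEq V] in
lemma cutSize_pos {S T : Finset V} {u v : V} (hu : u ∈ S) (hv : v ∈ T) (h : G.Adj u v) :
    0 < cutSize G S T := by
  classical
  exact Finset.card_pos.2 ⟨(u, v), (SimpleGraph.mem_interedges_iff G).2 ⟨hu, hv, h⟩⟩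

lemma degreeSum_union {S T : Finset V} (h : Disjoint S T) :
    degreeSum G (S ∪ T) = degreeSum G S + degreeSum G T :=
  Finset.sum_union h

omit [DecidableEq V] in
lemma degreeSum_mono {S T : Finset V} (h : S ⊆ T) : degreeSum G S ≤ degreeSum G T :=
  Finset.sum_le_sum_of_subset h

omit [DecidableEq V] in
lemma degreeSum_univ : degreeSum G Finset.univ = 2 * numEdges G := by
  classical
  rw [degreeSum, G.sum_degrees_eq_twice_card_edges, numEdges, ← SimpleGraph.coe_edgeFinset,
    Set.ncard_coe_finset]

lemma degreeSum_add_le {S T : Finset V} (h : Disjoint S T) :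
    degreeSum G S + degreeSum G T ≤ 2 * numEdges G := by
  rw [← degreeSum_union G h, ← degreeSum_univ]
  exact degreeSum_mono G (Finset.subset_univ _)

open Classical in
omit [DecidableEq V] in
lemma degree_eq_sum (u : V) : G.degree u = ∑ v, if G.Adj u v then 1 else 0 := by
  rw [← Finset.card_filter, ← SimpleGraph.card_neighborFinset_eq_degree]
  congr 1
  ext v
  simp

omit [DecidableEq V] in
/-- Each internal edge of `c` is counted twice among the ordered adjacent pairs in `c`. -/
lemma two_mul_internalEdges (c : Finset V) : 2 * internalEdges G c = cutSize G c c := by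
  classical
  -- the spanning subgraph whose edges are the internal edges of `c`
  let H : SimpleGraph V :=
    { Adj := fun u v => G.Adj u v ∧ u ∈ c ∧ v ∈ c
      symm := ⟨fun u v h => ⟨h.1.symm, h.2.2, h.2.1⟩⟩
      loopless := ⟨fun u h => h.1.ne rfl⟩ }
  have hH : H.edgeSet = {e ∈ G.edgeSet | ∀ v ∈ e, v ∈ c} := by
    ext e
    induction e with
    | h u v => simp [H]
  have h1 := degreeSum_univ H
  rw [numEdges, hH] at h1
  rw [internalEdges, ← h1, cutSize_eq_sum, degreeSum]
  simp only [degree_eq_sum, H]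
  rw [← Finset.sum_subset (Finset.subset_univ c)]
  · refine Finset.sum_congr rfl fun u hu => ?_
    rw [← Finset.sum_subset (Finset.subset_univ c)]
    · exact Finset.sum_congr rfl fun v hv => by simp [hu, hv]
    · intro v _ hv
      simp [hv]
  · intro u _ hu
    simp [hu]

lemma internalEdges_union {S T : Finset V} (h : Disjoint S T) :
    internalEdges G (S ∪ T) = internalEdges G S + internalEdges G T + cutSize G S T := by
  have h1 := two_mul_internalEdges G (S ∪ T)
  rw [cutSize_union_left G h, cutSize_union_right G _ h, cutSize_union_right G _ h,
    cutSize_comm G T S, ← two_mul_internalEdges, ← two_mul_internalEdges] at h1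
  omega

end Counting

/-! ### Merging and splitting clusters -/

section Exchange

variable {V : Type u} [Fintype V] [DecidableEq V] {G : SimpleGraph V}

lemma exists_merge (P : Clustering V) {a b : Finset V} (ha : a ∈ P.parts) (hb : b ∈ P.parts) :
    ∃ Q : Clustering V, Q.parts = insert (a ∪ b) ((P.parts.erase a).erase b) := by
  refine ⟨Finpartition.ofExistsUnique _ (fun _ _ => Finset.subset_univ _) (fun v _ => ?_) ?_, rfl⟩
  · obtain ⟨c, ⟨hc, hvc⟩, hu⟩ := P.existsUnique_mem (Finset.mem_univ v)
    by_cases hv : v ∈ a ∪ b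
    · refine ⟨a ∪ b, by simp [Finset.mem_union.1 hv], ?_⟩
      rintro d ⟨hd, hvd⟩
      rcases Finset.mem_insert.1 hd with rfl | hd
      · rfl
      simp only [Finset.mem_erase] at hd
      have hdc : d = c := hu d ⟨hd.2.2, hvd⟩
      rcases Finset.mem_union.1 hv with h | h
      · exact absurd (hdc.trans (hu a ⟨ha, h⟩).symm) hd.2.1
      · exact absurd (hdc.trans (hu b ⟨hb, h⟩).symm) hd.1
    · refine ⟨c, ⟨?_, hvc⟩, ?_⟩
      · simp only [Finset.mem_union, not_or] at hv
        refine Finset.mem_insert_of_mem (Finset.mem_erase.2 ⟨?_, Finset.mem_erase.2 ⟨?_, hc⟩⟩)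
        · rintro rfl; exact hv.2 hvc
        · rintro rfl; exact hv.1 hvc
      · rintro d ⟨hd, hvd⟩
        rcases Finset.mem_insert.1 hd with rfl | hd
        · exact absurd hvd hv
        exact hu d ⟨Finset.mem_of_mem_erase (Finset.mem_of_mem_erase hd), hvd⟩
  · intro h
    rcases Finset.mem_insert.1 h with h | h
    · exact P.ne_empty ha (Finset.union_eq_empty.1 h.symm).1
    · exact P.empty_notMem_parts (Finset.mem_of_mem_erase (Finset.mem_of_mem_erase h))

lemma exists_split (P : Clustering V) {a b : Finset V} (hab : Disjoint a b) (ha : a.Nonempty)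
    (hb : b.Nonempty) (hc : a ∪ b ∈ P.parts) :
    ∃ Q : Clustering V, Q.parts = insert a (insert b (P.parts.erase (a ∪ b))) := by
  refine ⟨Finpartition.ofExistsUnique _ (fun _ _ => Finset.subset_univ _) (fun v _ => ?_) ?_, rfl⟩
  · obtain ⟨c, ⟨hc', hvc⟩, hu⟩ := P.existsUnique_mem (Finset.mem_univ v)
    have key : ∀ d ∈ P.parts.erase (a ∪ b), v ∈ d → v ∉ a ∪ b := fun d hd hvd hv =>
      (Finset.mem_erase.1 hd).1
        ((hu d ⟨Finset.mem_of_mem_erase hd, hvd⟩).trans (hu _ ⟨hc, hv⟩).symm)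
    by_cases hva : v ∈ a
    · refine ⟨a, by simp [hva], ?_⟩
      rintro d ⟨hd, hvd⟩
      rcases Finset.mem_insert.1 hd with rfl | hd
      · rfl
      rcases Finset.mem_insert.1 hd with rfl | hd
      · exact absurd hvd (Finset.disjoint_left.1 hab hva)
      · exact absurd (Finset.mem_union_left _ hva) (key d hd hvd)
    by_cases hvb : v ∈ b
    · refine ⟨b, by simp [hvb], ?_⟩
      rintro d ⟨hd, hvd⟩
      rcases Finset.mem_insert.1 hd with rfl | hd
      · exact absurd hvd hva
      rcases Finset.mem_insert.1 hd with rfl | hd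
      · rfl
      · exact absurd (Finset.mem_union_right _ hvb) (key d hd hvd)
    · refine ⟨c, ⟨?_, hvc⟩, ?_⟩
      · refine Finset.mem_insert_of_mem (Finset.mem_insert_of_mem (Finset.mem_erase.2 ⟨?_, hc'⟩))
        rintro rfl
        simp [hva, hvb] at hvc
      · rintro d ⟨hd, hvd⟩
        rcases Finset.mem_insert.1 hd with rfl | hd
        · exact absurd hvd hva
        rcases Finset.mem_insert.1 hd with rfl | hd
        · exact absurd hvd hvb
        · exact hu d ⟨Finset.mem_of_mem_erase hd, hvd⟩
  · intro h
    rcases Finset.mem_insert.1 h with h | h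
    · exact ha.ne_empty h.symm
    rcases Finset.mem_insert.1 h with h | h
    · exact hb.ne_empty h.symm
    · exact P.empty_notMem_parts (Finset.mem_of_mem_erase h)

/-- The effect on the modularity of replacing the clusters `a` and `b` by their union; all other
clusters are collected in `R`. -/
lemma modularity_merge_sub {P Q : Clustering V} {a b : Finset V} {R : Finset (Finset V)}
    (hP : P.parts = insert a (insert b R)) (hQ : Q.parts = insert (a ∪ b) R) (hab : Disjoint a b)
    (hne : a ≠ b) (haR : a ∉ R) (hbR : b ∉ R) (habR : a ∪ b ∉ R) :
    modularity G Q - modularity G P = (cutSize G a b : ℝ) / numEdges G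
      - 2 * (degreeSum G a * degreeSum G b) / (2 * numEdges G) ^ 2 := by
  rw [modularity, modularity, hP, hQ, Finset.sum_insert habR,
    Finset.sum_insert (by simp [hne, haR]), Finset.sum_insert hbR, internalEdges_union G hab,
    degreeSum_union G hab]
  push_cast
  ring

/-- The right-hand side of `modularity_merge_sub` with the denominators cleared. -/
lemma merge_gain_nonpos_iff (e x y m : ℕ) (hm : 0 < m) :
    (e : ℝ) / m - 2 * (x * y) / (2 * m) ^ 2 ≤ 0 ↔ 2 * m * e ≤ x * y := by
  have hm' : (0 : ℝ) < m := by exact_mod_cast hm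
  have h : (e : ℝ) / m - 2 * (x * y) / (2 * m) ^ 2 = (2 * m * e - x * y) / (2 * m ^ 2) := by
    field_simp
  rw [h, div_le_iff₀ (by positivity), zero_mul, sub_nonpos]
  exact_mod_cast Iff.rfl

lemma merge_gain_nonneg_iff (e x y m : ℕ) (hm : 0 < m) :
    0 ≤ (e : ℝ) / m - 2 * (x * y) / (2 * m) ^ 2 ↔ x * y ≤ 2 * m * e := by
  have hm' : (0 : ℝ) < m := by exact_mod_cast hm
  have h : (e : ℝ) / m - 2 * (x * y) / (2 * m) ^ 2 = (2 * m * e - x * y) / (2 * m ^ 2) := by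
    field_simp
  rw [h, le_div_iff₀ (by positivity), zero_mul, sub_nonneg]
  exact_mod_cast Iff.rfl

/-- Merging two adjacent clusters of an optimal clustering is not profitable. -/
theorem IsModularityOptimal.le_of_adj {P : Clustering V} (hP : IsModularityOptimal G P)
    {a b : Finset V} (ha : a ∈ P.parts) (hb : b ∈ P.parts) (hab : a ≠ b) {u v : V} (hu : u ∈ a)
    (hv : v ∈ b) (huv : G.Adj u v) :
    2 * numEdges G * cutSize G a b ≤ degreeSum G a * degreeSum G b := by
  classical
  have hdisj : Disjoint a b := P.disjoint ha hb hab
  obtain ⟨Q, hQ⟩ := exists_merge P ha hb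
  have hconn : HasConnectedClusters G Q := by
    intro c hc
    rw [hQ] at hc
    rcases Finset.mem_insert.1 hc with rfl | hc
    · rw [Finset.coe_union]
      exact SimpleGraph.connected_induce_union (hP.1 a ha).preconnected
        (hP.1 b hb).preconnected hu hv huv
    · exact hP.1 c (Finset.mem_of_mem_erase (Finset.mem_of_mem_erase hc))
  have hPR : P.parts = insert a (insert b ((P.parts.erase a).erase b)) := by
    rw [Finset.insert_erase (Finset.mem_erase.2 ⟨hab.symm, hb⟩), Finset.insert_erase ha]
  have hR : a ∪ b ∉ (P.parts.erase a).erase b := by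
    intro h
    have h' := Finset.mem_erase.1 (Finset.mem_of_mem_erase h)
    exact h'.1 (P.eq_of_mem_parts h'.2 ha (Finset.mem_union_left _ hu) hu)
  have hle := sub_nonpos.2 (hP.2 Q hconn)
  rw [modularity_merge_sub hPR hQ hdisj hab (by simp) (by simp) hR] at hle
  refine (merge_gain_nonpos_iff _ _ _ _ ?_).1 hle
  exact Set.ncard_pos (Set.toFinite _) |>.2 ⟨s(u, v), huv⟩

/-- Splitting a cluster of an optimal clustering into two connected pieces is not profitable. -/
theorem IsModularityOptimal.le_of_union_mem {P : Clustering V} (hP : IsModularityOptimal G P)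
    {a b : Finset V} (hab : Disjoint a b) (ha : (G.induce (a : Set V)).Connected)
    (hb : (G.induce (b : Set V)).Connected) (hc : a ∪ b ∈ P.parts) :
    degreeSum G a * degreeSum G b ≤ 2 * numEdges G * cutSize G a b := by
  classical
  have hane : a.Nonempty := by
    obtain ⟨⟨x, hx⟩⟩ := ha.nonempty
    exact ⟨x, hx⟩
  have hbne : b.Nonempty := by
    obtain ⟨⟨x, hx⟩⟩ := hb.nonempty
    exact ⟨x, hx⟩
  have hne : a ≠ b := fun h => hane.ne_empty (disjoint_self.1 (h ▸ hab))
  rcases Nat.eq_zero_or_pos (numEdges G) with hm | hm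
  · have := degreeSum_add_le G hab
    have : degreeSum G a = 0 := by omega
    simp [this]
  obtain ⟨Q, hQ⟩ := exists_split P hab hane hbne hc
  have hconn : HasConnectedClusters G Q := by
    intro c hc
    rw [hQ] at hc
    rcases Finset.mem_insert.1 hc with rfl | hc
    · exact ha
    rcases Finset.mem_insert.1 hc with rfl | hc
    · exact hb
    · exact hP.1 c (Finset.mem_of_mem_erase hc)
  have hPR : P.parts = insert (a ∪ b) (P.parts.erase (a ∪ b)) := (Finset.insert_erase hc).symm
  have key : ∀ d ∈ P.parts.erase (a ∪ b), ∀ x ∈ d, x ∉ a ∪ b := fun d hd x hx hx' =>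
    (Finset.mem_erase.1 hd).1 (P.eq_of_mem_parts (Finset.mem_of_mem_erase hd) hc hx hx')
  have haR : a ∉ P.parts.erase (a ∪ b) := fun h =>
    hane.elim fun x hx => key a h x hx (Finset.mem_union_left _ hx)
  have hbR : b ∉ P.parts.erase (a ∪ b) := fun h =>
    hbne.elim fun x hx => key b h x hx (Finset.mem_union_right _ hx)
  have hle := sub_nonneg.2 (hP.2 Q hconn)
  rw [modularity_merge_sub hQ hPR hab hne haR hbR (by simp)] at hle
  exact (merge_gain_nonneg_iff _ _ _ _ hm).1 hle

end Exchange

/-! ### Connected clusters and vertices of degree one -/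

section SameCluster

variable {V : Type u} [Fintype V] [DecidableEq V] {G : SimpleGraph V} {P : Clustering V}

lemma sameCluster_iff {u v : V} : SameCluster P u v ↔ P.part u = P.part v := by
  constructor
  · rintro ⟨c, hc, hu, hv⟩
    rw [P.part_eq_of_mem hc hu, P.part_eq_of_mem hc hv]
  · intro h
    exact ⟨P.part u, by simp, by simp, by simp [h]⟩

omit [Fintype V] [DecidableEq V] in
/-- A connected set of vertices that meets a union of components lies inside it. -/
lemma subset_of_induce_connected {c S : Finset V} (hc : (G.induce (c : Set V)).Connected)
    (hS : ∀ u ∈ S, ∀ v, G.Adj u v → v ∈ S) {x : V} (hxc : x ∈ c) (hxS : x ∈ S) : c ⊆ S := by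
  intro y hy
  obtain ⟨w⟩ := hc.preconnected ⟨x, hxc⟩ ⟨y, hy⟩
  have : ∀ (p q : (c : Set V)), (G.induce (c : Set V)).Walk p q → (p : V) ∈ S → (q : V) ∈ S := by
    intro p q w
    induction w with
    | nil => exact id
    | cons h _ ih => exact fun hp => ih (hS _ hp _ h)
  exact this _ _ w hxS

/-- In an optimal clustering a vertex of degree one lies in the cluster of its neighbour: otherwise
it is a cluster of degree sum `1`, and merging it into the neighbouring cluster is profitable
because the degree sum of the latter is smaller than twice the number of edges. -/
theorem IsModularityOptimal.part_eq_of_leaf (hP : IsModularityOptimal G P) {v w : V}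
    (hv : ∀ z, G.Adj v z ↔ z = w) : P.part v = P.part w := by
  classical
  by_contra hne
  have hvw : G.Adj v w := (hv w).2 rfl
  -- a path inside the cluster of `v` would leave `v` through `w`
  have hpart : P.part v = {v} := by
    refine Finset.Subset.antisymm ?_ (by simp)
    intro y hy
    by_contra hyv
    have hyv : y ≠ v := by simpa using hyv
    have hconn := hP.1 (P.part v) (by simp)
    obtain ⟨p⟩ := hconn.preconnected ⟨v, by simp⟩ ⟨y, hy⟩
    cases p with
    | nil => exact hyv rfl
    | @cons _ z _ h _ =>
      have hz : (z : V) = w := (hv z).1 h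
      have hw : w ∈ P.part v := hz ▸ z.2
      exact hne (P.part_eq_of_mem (by simp) hw).symm
  have h1 := hP.le_of_adj (a := P.part v) (b := P.part w) (by simp) (by simp) hne (u := v) (v := w)
    (by simp) (by simp) hvw
  have h2 : 0 < cutSize G (P.part v) (P.part w) := cutSize_pos G (by simp) (by simp) hvw
  have h3 : degreeSum G (P.part v) = 1 := by
    rw [hpart, degreeSum, Finset.sum_singleton, degree_eq_sum]
    simp [hv]
  have hv' : P.part v ∈ P.parts := by simp
  have hw' : P.part w ∈ P.parts := by simp
  have h4 : degreeSum G (P.part v) + degreeSum G (P.part w) ≤ 2 * numEdges G :=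
    degreeSum_add_le G (P.disjoint hv' hw' hne)
  have h5 := Nat.le_mul_of_pos_right (2 * numEdges G) h2
  rw [h3] at h1 h4
  omega

end SameCluster

/-! ### Double stars -/

section DoubleStar

variable {V : Type u} [Fintype V] [DecidableEq V] {G : SimpleGraph V}

/-- `a ∪ b` is a component of `G` that is a double star: `x ∈ a` and `y ∈ b` are adjacent, the
other vertices of `a` are leaves at `x`, and the other vertices of `b` are leaves at `y`. -/
structure IsDoubleStar (G : SimpleGraph V) (a b : Finset V) (x y : V) : Prop where
  mem_left : x ∈ a
  mem_right : y ∈ b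
  disjoint : Disjoint a b
  adj_left : ∀ v, G.Adj x v ↔ v = y ∨ v ∈ a ∧ v ≠ x
  adj_right : ∀ v, G.Adj y v ↔ v = x ∨ v ∈ b ∧ v ≠ y
  leaf_left : ∀ u ∈ a, u ≠ x → ∀ v, G.Adj u v ↔ v = x
  leaf_right : ∀ u ∈ b, u ≠ y → ∀ v, G.Adj u v ↔ v = y

namespace IsDoubleStar

variable {a b : Finset V} {x y : V}

omit [Fintype V] [DecidableEq V] in
lemma symm (h : IsDoubleStar G a b x y) : IsDoubleStar G b a y x :=
  ⟨h.mem_right, h.mem_left, h.disjoint.symm, h.adj_right, h.adj_left, h.leaf_right, h.leaf_left⟩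

omit [Fintype V] [DecidableEq V] in
lemma adj (h : IsDoubleStar G a b x y) : G.Adj x y := (h.adj_left y).2 (Or.inl rfl)

lemma degreeSum_left (h : IsDoubleStar G a b x y) : degreeSum G a = 2 * a.card - 1 := by
  classical
  have hx : G.degree x = a.card := by
    have hN : G.neighborFinset x = insert y (a.erase x) := by
      ext v
      simp [h.adj_left, and_comm]
    have hy : y ∉ a.erase x := fun hy =>
      Finset.disjoint_left.1 h.disjoint (Finset.mem_of_mem_erase hy) h.mem_right
    rw [← SimpleGraph.card_neighborFinset_eq_degree, hN, Finset.card_insert_of_notMem hy,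
      Finset.card_erase_add_one h.mem_left]
  have hl : ∑ u ∈ a.erase x, G.degree u = (a.erase x).card := by
    rw [Finset.card_eq_sum_ones]
    refine Finset.sum_congr rfl fun u hu => ?_
    rw [degree_eq_sum]
    simp [h.leaf_left u (Finset.mem_of_mem_erase hu) (Finset.ne_of_mem_erase hu)]
  have h1 := Finset.card_erase_add_one h.mem_left
  rw [degreeSum]
  have h2 := Finset.add_sum_erase a (fun u => G.degree u) h.mem_left
  simp only [hl, hx] at h2
  rw [← h2]
  omega

lemma degreeSum_right (h : IsDoubleStar G a b x y) : degreeSum G b = 2 * b.card - 1 :=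
  h.symm.degreeSum_left

omit [Fintype V] [DecidableEq V] in
lemma cutSize_eq_one (h : IsDoubleStar G a b x y) : cutSize G a b = 1 := by
  classical
  rw [cutSize, Finset.card_eq_one]
  refine ⟨(x, y), ?_⟩
  ext ⟨u, v⟩
  rw [SimpleGraph.mem_interedges_iff, Finset.mem_singleton, Prod.mk.injEq]
  constructor
  · rintro ⟨hu, hv, huv⟩
    have hux : u = x := by
      by_contra hux
      obtain rfl := (h.leaf_left u hu hux v).1 huv
      exact Finset.disjoint_left.1 h.disjoint h.mem_left hv
    subst hux
    rcases (h.adj_left v).1 huv with rfl | hva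
    · exact ⟨rfl, rfl⟩
    · exact absurd hv (Finset.disjoint_left.1 h.disjoint hva.1)
  · rintro ⟨rfl, rfl⟩
    exact ⟨h.mem_left, h.mem_right, h.adj⟩

omit [Fintype V] [DecidableEq V] in
lemma connected_left (h : IsDoubleStar G a b x y) : (G.induce (a : Set V)).Connected := by
  rw [SimpleGraph.connected_iff_exists_forall_reachable]
  refine ⟨⟨x, h.mem_left⟩, fun ⟨v, hv⟩ => ?_⟩
  by_cases hvx : v = x
  · subst hvx
    exact SimpleGraph.Reachable.refl _
  · exact SimpleGraph.Adj.reachable (show G.Adj x v from (h.adj_left v).2 (Or.inr ⟨hv, hvx⟩))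

omit [Fintype V] in
lemma closed (h : IsDoubleStar G a b x y) : ∀ u ∈ a ∪ b, ∀ v, G.Adj u v → v ∈ a ∪ b := by
  have key : ∀ {a b : Finset V} {x y : V}, IsDoubleStar G a b x y →
      ∀ u ∈ a, ∀ v, G.Adj u v → v ∈ a ∪ b := by
    intro a b x y h u hu v huv
    by_cases hux : u = x
    · subst hux
      rcases (h.adj_left v).1 huv with rfl | hv
      · exact Finset.mem_union_right _ h.mem_right
      · exact Finset.mem_union_left _ hv.1
    · rw [(h.leaf_left u hu hux v).1 huv]
      exact Finset.mem_union_left _ h.mem_left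
  intro u hu v huv
  rcases Finset.mem_union.1 hu with hu | hu
  · exact key h u hu v huv
  · rw [Finset.union_comm]
    exact key h.symm u hu v huv

variable {P : Clustering V}

lemma subset_part_left (h : IsDoubleStar G a b x y) (hP : IsModularityOptimal G P) :
    a ⊆ P.part x := by
  intro u hu
  by_cases hux : u = x
  · simp [hux]
  · rw [← hP.part_eq_of_leaf (h.leaf_left u hu hux)]
    simp

lemma part_subset_union (h : IsDoubleStar G a b x y) (hP : IsModularityOptimal G P) :
    P.part x ⊆ a ∪ b :=
  subset_of_induce_connected (hP.1 _ (by simp)) h.closed (x := x) (by simp)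
    (Finset.mem_union_left _ h.mem_left)

lemma part_eq_union (h : IsDoubleStar G a b x y) (hP : IsModularityOptimal G P)
    (hxy : P.part x = P.part y) : P.part x = a ∪ b := by
  refine Finset.Subset.antisymm (h.part_subset_union hP) (Finset.union_subset ?_ ?_)
  · exact h.subset_part_left hP
  · rw [hxy]
    exact h.symm.subset_part_left hP

lemma part_eq_left (h : IsDoubleStar G a b x y) (hP : IsModularityOptimal G P)
    (hxy : P.part x ≠ P.part y) : P.part x = a := by
  refine Finset.Subset.antisymm (fun u hu => ?_) (h.subset_part_left hP)
  rcases Finset.mem_union.1 (h.part_subset_union hP hu) with hua | hub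
  · exact hua
  · have hu' : u ∈ P.part y := h.symm.subset_part_left hP hub
    exact absurd (P.eq_of_mem_parts (by simp) (by simp) hu hu') hxy

/-- A double star component is one cluster if the network has enough edges. -/
theorem part_eq_of_lt (h : IsDoubleStar G a b x y) (hP : IsModularityOptimal G P)
    (hlt : (2 * a.card - 1) * (2 * b.card - 1) < 2 * numEdges G) : P.part x = P.part y := by
  by_contra hxy
  have ha := h.part_eq_left hP hxy
  have hb := h.symm.part_eq_left hP (Ne.symm hxy)
  have h1 := hP.le_of_adj (a := a) (b := b) (by rw [← ha]; simp) (by rw [← hb]; simp)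
    (by rwa [ha, hb] at hxy) h.mem_left h.mem_right h.adj
  rw [h.cutSize_eq_one, h.degreeSum_left, h.degreeSum_right] at h1
  omega

/-- A double star component is split into its two stars if the network has few edges. -/
theorem part_ne_of_lt (h : IsDoubleStar G a b x y) (hP : IsModularityOptimal G P)
    (hlt : 2 * numEdges G < (2 * a.card - 1) * (2 * b.card - 1)) : P.part x ≠ P.part y := by
  intro hxy
  have hc := h.part_eq_union hP hxy
  have h1 := hP.le_of_union_mem h.disjoint h.connected_left h.symm.connected_left
    (by rw [← hc]; simp)
  rw [h.cutSize_eq_one, h.degreeSum_left, h.degreeSum_right] at h1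
  omega

lemma two_mul_numEdges (h : IsDoubleStar G a b x y) (huniv : Finset.univ = a ∪ b) :
    2 * numEdges G = (2 * a.card - 1) + (2 * b.card - 1) := by
  rw [← degreeSum_univ, huniv, degreeSum_union G h.disjoint, h.degreeSum_left, h.degreeSum_right]

lemma two_mul_numEdges_of_pair {a' b' : Finset V} {x' y' : V} (h : IsDoubleStar G a b x y)
    (h' : IsDoubleStar G a' b' x' y') (hd : Disjoint (a ∪ b) (a' ∪ b'))
    (huniv : Finset.univ = (a ∪ b) ∪ (a' ∪ b')) :
    2 * numEdges G = ((2 * a.card - 1) + (2 * b.card - 1)) +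
      ((2 * a'.card - 1) + (2 * b'.card - 1)) := by
  rw [← degreeSum_univ, huniv, degreeSum_union G hd, degreeSum_union G h.disjoint,
    degreeSum_union G h'.disjoint, h.degreeSum_left, h.degreeSum_right, h'.degreeSum_left,
    h'.degreeSum_right]

omit [Fintype V] in
lemma of_adj_iff (h : IsDoubleStar G a b x y) {H : SimpleGraph V}
    (hH : ∀ u ∈ a ∪ b, ∀ v, H.Adj u v ↔ G.Adj u v) : IsDoubleStar H a b x y where
  mem_left := h.mem_left
  mem_right := h.mem_right
  disjoint := h.disjoint
  adj_left v := (hH x (Finset.mem_union_left _ h.mem_left) v).trans (h.adj_left v)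
  adj_right v := (hH y (Finset.mem_union_right _ h.mem_right) v).trans (h.adj_right v)
  leaf_left u hu hux v := (hH u (Finset.mem_union_left _ hu) v).trans (h.leaf_left u hu hux v)
  leaf_right u hu huy v := (hH u (Finset.mem_union_right _ hu) v).trans (h.leaf_right u hu huy v)

omit [Fintype V] in
lemma induce (h : IsDoubleStar G a b x y) {W : Finset V} (hx : x ∈ W) (hy : y ∈ W) :
    IsDoubleStar (G.comap (Subtype.val : {v // v ∈ W} → V)) (a.subtype (· ∈ W))
      (b.subtype (· ∈ W)) ⟨x, hx⟩ ⟨y, hy⟩ where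
  mem_left := Finset.mem_subtype.2 h.mem_left
  mem_right := Finset.mem_subtype.2 h.mem_right
  disjoint := Finset.disjoint_left.2 fun _ h1 h2 =>
    Finset.disjoint_left.1 h.disjoint (Finset.mem_subtype.1 h1) (Finset.mem_subtype.1 h2)
  adj_left v := by simp [h.adj_left, Subtype.ext_iff]
  adj_right v := by simp [h.adj_right, Subtype.ext_iff]
  leaf_left u hu hux v := by
    simp [h.leaf_left u (Finset.mem_subtype.1 hu) (fun e => hux (Subtype.ext e)), Subtype.ext_iff]
  leaf_right u hu huy v := by
    simp [h.leaf_right u (Finset.mem_subtype.1 hu) (fun e => huy (Subtype.ext e)), Subtype.ext_iff]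

end IsDoubleStar

end DoubleStar

/-! ### Explicit forests -/

section Forests

/-- The forest on `n` vertices in which `f i` is the parent of `i`, the roots being the fixed
points of `f`. -/
def forest {n : ℕ} (f : Fin n → Fin n) : SimpleGraph (ULift.{u} (Fin n)) where
  Adj i j := i ≠ j ∧ (f i.down = j.down ∨ f j.down = i.down)
  symm := ⟨fun _ _ h => ⟨h.1.symm, h.2.symm⟩⟩
  loopless := ⟨fun _ h => h.1 rfl⟩

instance {n : ℕ} (f : Fin n → Fin n) : DecidableRel (forest.{u} f).Adj :=
  fun i j => inferInstanceAs (Decidable (i ≠ j ∧ (f i.down = j.down ∨ f j.down = i.down)))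

/-- The set of vertices with a label in the interval from `i` to `j`. -/
def block {n : ℕ} (i j : Fin n) : Finset (ULift.{u} (Fin n)) :=
  (Finset.Icc i j).map Equiv.ulift.symm.toEmbedding

lemma isDoubleStar_iff {V : Type u} {G : SimpleGraph V} {a b : Finset V} {x y : V} :
    IsDoubleStar G a b x y ↔ x ∈ a ∧ y ∈ b ∧ Disjoint a b ∧
      (∀ v, G.Adj x v ↔ v = y ∨ v ∈ a ∧ v ≠ x) ∧ (∀ v, G.Adj y v ↔ v = x ∨ v ∈ b ∧ v ≠ y) ∧
      (∀ u ∈ a, u ≠ x → ∀ v, G.Adj u v ↔ v = x) ∧ (∀ u ∈ b, u ≠ y → ∀ v, G.Adj u v ↔ v = y) :=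
  ⟨fun ⟨h1, h2, h3, h4, h5, h6, h7⟩ => ⟨h1, h2, h3, h4, h5, h6, h7⟩,
    fun ⟨h1, h2, h3, h4, h5, h6, h7⟩ => ⟨h1, h2, h3, h4, h5, h6, h7⟩⟩

instance {V : Type u} [Fintype V] [DecidableEq V] {G : SimpleGraph V} [DecidableRel G.Adj]
    {a b : Finset V} {x y : V} : Decidable (IsDoubleStar G a b x y) :=
  decidable_of_iff _ isDoubleStar_iff.symm

end Forests

/-! ### Disjoint unions of cliques -/

section Richness

variable {V : Type u} [Fintype V] [DecidableEq V]

/-- The disjoint union of complete graphs on the clusters of `P`. -/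
def cliqueUnion (P : Clustering V) : SimpleGraph V where
  Adj u v := u ≠ v ∧ v ∈ P.part u
  symm := ⟨fun u v h => ⟨h.1.symm, (P.mem_part_iff_part_eq_part (by simp) (by simp)).2
    ((P.mem_part_iff_part_eq_part (by simp) (by simp)).1 h.2).symm⟩⟩
  loopless := ⟨fun _ h => h.1 rfl⟩

lemma degreeSum_cliqueUnion (P : Clustering V) {K c : Finset V} (hK : K ∈ P.parts) (hc : c ⊆ K) :
    degreeSum (cliqueUnion P) c = c.card * (K.card - 1) := by
  classical
  rw [degreeSum, Finset.sum_const_nat]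
  intro v hv
  have hN : (cliqueUnion P).neighborFinset v = K.erase v := by
    ext w
    rw [SimpleGraph.mem_neighborFinset, Finset.mem_erase, ne_comm,
      ← P.part_eq_of_mem hK (hc hv)]
    rfl
  rw [← SimpleGraph.card_neighborFinset_eq_degree, hN, Finset.card_erase_of_mem (hc hv)]

lemma cutSize_cliqueUnion (P : Clustering V) {K c d : Finset V} (hK : K ∈ P.parts) (hc : c ⊆ K)
    (hd : d ⊆ K) (hcd : Disjoint c d) : cutSize (cliqueUnion P) c d = c.card * d.card := by
  classical
  rw [cutSize_eq_sum, Finset.sum_const_nat]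
  intro u hu
  rw [Finset.card_eq_sum_ones]
  refine Finset.sum_congr rfl fun v hv => if_pos ⟨?_, ?_⟩
  · rintro rfl
    exact Finset.disjoint_left.1 hcd hu hv
  · rw [P.part_eq_of_mem hK (hc hu)]
    exact hd hv

lemma clustering_ext {P Q : Clustering V} (h : ∀ x, P.part x = Q.part x) : P = Q := by
  have key : ∀ {P Q : Clustering V}, (∀ x, P.part x = Q.part x) → P.parts ⊆ Q.parts := by
    intro P Q h c hc
    obtain ⟨x, hx⟩ := P.nonempty_of_mem_parts hc
    rw [← P.part_eq_of_mem hc hx, h x]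
    simp
  exact Finpartition.ext (Finset.Subset.antisymm (key h) (key fun x => (h x).symm))

/-- Splitting a clique of a disjoint union of cliques is never optimal: if `c` and `d` are two
clusters inside a clique with `k` vertices, the merger criterion would give `2|E| ≤ (k - 1)²`,
whereas the clique alone contributes `k(k - 1)` to `2|E|`. -/
theorem IsModularityOptimal.eq_of_cliqueUnion {P Q : Clustering V}
    (hQ : IsModularityOptimal (cliqueUnion P) Q) : Q = P := by
  have hsub : ∀ x, Q.part x ⊆ P.part x := by
    intro x
    refine subset_of_induce_connected (hQ.1 _ (by simp)) (fun u hu v huv => ?_) (x := x) (by simp)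
      (by simp)
    rw [← P.part_eq_of_mem (by simp) hu]
    exact huv.2
  refine clustering_ext fun x => Finset.Subset.antisymm (hsub x) fun y hy => ?_
  by_contra hyx
  have hne : Q.part x ≠ Q.part y := fun h => hyx (h ▸ by simp)
  have hxy : x ≠ y := by
    rintro rfl
    exact hne rfl
  have hK : P.part x ∈ P.parts := by simp
  have hPy : P.part y = P.part x := P.part_eq_of_mem hK hy
  have hx' : Q.part x ∈ Q.parts := by simp
  have hy' : Q.part y ∈ Q.parts := by simp
  have hd : Disjoint (Q.part x) (Q.part y) := Q.disjoint hx' hy' hne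
  have hle := hQ.le_of_adj hx' hy' hne (u := x) (v := y) (by simp) (by simp) ⟨hxy, hy⟩
  have hm : (P.part x).card * ((P.part x).card - 1) ≤ 2 * numEdges (cliqueUnion P) := by
    rw [← degreeSum_univ, ← degreeSum_cliqueUnion P hK subset_rfl]
    exact degreeSum_mono _ (Finset.subset_univ _)
  have hy2 : Q.part y ⊆ P.part x := hPy ▸ hsub y
  rw [cutSize_cliqueUnion P hK (hsub x) hy2 hd, degreeSum_cliqueUnion P hK (hsub x),
    degreeSum_cliqueUnion P hK hy2] at hle
  have hk : 1 < (P.part x).card := Finset.one_lt_card.2 ⟨x, by simp, y, hy, hxy⟩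
  have hp : 0 < (Q.part x).card * (Q.part y).card :=
    Nat.mul_pos (Finset.card_pos.2 ⟨x, by simp⟩) (Finset.card_pos.2 ⟨y, by simp⟩)
  generalize (Q.part x).card = p at *
  generalize (Q.part y).card = q at *
  generalize (P.part x).card = k at *
  obtain ⟨j, rfl⟩ : ∃ j, k = j + 2 := ⟨k - 2, by omega⟩
  have e : j + 2 - 1 = j + 1 := rfl
  rw [e] at hle hm
  have h1 := Nat.mul_le_mul_right (p * q) hm
  nlinarith [Nat.mul_pos hp (Nat.succ_pos j)]

end Richness

theorem richness {M : ClusteringMethod.{u}} (hM : IsModularityOptimisation M) : Richness M :=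
  fun V _ _ P => ⟨cliqueUnion P, (hM V (cliqueUnion P)).eq_of_cliqueUnion⟩

/-! ### Consistency axioms -/

section Consistency

lemma numEdges_lt_of_lt {V : Type u} [Fintype V] {G H : SimpleGraph V} (h : G < H) :
    numEdges G < numEdges H :=
  Set.ncard_lt_ncard (SimpleGraph.edgeSet_ssubset_edgeSet.2 h) (Set.toFinite _)

lemma StandardConsistency.kleinberg {M : ClusteringMethod.{u}} (h : StandardConsistency M) :
    KleinbergRefinementConsistency M :=
  fun V _ _ G H hGH => (h V G H hGH).le

lemma RefinementConsistency.kleinberg {M : ClusteringMethod.{u}} (h : RefinementConsistency M) :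
    KleinbergRefinementConsistency M :=
  fun V _ _ G H hGH => (h V G H hGH).1

/-- A double star with one and two leaves, and a star with three leaves (rooted at `5`). -/
def smallForest : SimpleGraph (ULift.{u} (Fin 9)) :=
  forest ![1, 1, 1, 2, 2, 5, 5, 5, 5]

/-- `smallForest` together with an edge between two leaves of its starGraph. -/
def smallForestAddEdge : SimpleGraph (ULift.{u} (Fin 9)) :=
  smallForest ⊔ SimpleGraph.edge ⟨6⟩ ⟨7⟩

/-- The new edge lies inside a cluster, since both leaves are clustered with the centre of the star,
and raises `2|E|` from `14` to `16`, past the product `3 · 5` that decides whether the double star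
is split. -/
theorem not_kleinbergRefinementConsistency {M : ClusteringMethod.{u}}
    (hM : IsModularityOptimisation M) : ¬ KleinbergRefinementConsistency M := by
  intro hK
  have hG := hM _ smallForest.{u}
  have hH := hM _ smallForestAddEdge.{u}
  have s1 : IsDoubleStar smallForest.{u} (block 0 1) (block 2 4) ⟨1⟩ ⟨2⟩ := by
    unfold smallForest; decide
  -- a star is a double star in which one of the two stars is a single vertex
  have s2 : IsDoubleStar smallForest.{u} (block 5 7) (block 8 8) ⟨5⟩ ⟨8⟩ := by
    unfold smallForest; decide
  have s1' : IsDoubleStar smallForestAddEdge.{u} (block 0 1) (block 2 4) ⟨1⟩ ⟨2⟩ := by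
    refine s1.of_adj_iff fun u hu v => ?_
    have h6 : u ≠ ⟨6⟩ := by
      rintro rfl
      revert hu
      decide
    have h7 : u ≠ ⟨7⟩ := by
      rintro rfl
      revert hu
      decide
    simp [smallForestAddEdge, SimpleGraph.sup_adj, SimpleGraph.edge_adj, h6, h7]
  have hm : 2 * numEdges smallForest.{u} = 14 :=
    s1.two_mul_numEdges_of_pair s2 (by decide) (by decide)
  have hlt : smallForest.{u} < smallForestAddEdge :=
    SimpleGraph.lt_sup_edge _ _ _ (by decide) (by unfold smallForest; decide)
  have hm' := numEdges_lt_of_lt hlt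
  have c1 : (block 0 1 : Finset (ULift.{u} (Fin 9))).card = 2 := by decide
  have c2 : (block 2 4 : Finset (ULift.{u} (Fin 9))).card = 3 := by decide
  have hsplit := s1.part_ne_of_lt hG (by rw [c1, c2]; omega)
  have hwhole := s1'.part_eq_of_lt hH (by rw [c1, c2]; omega)
  have h67 : (M _ smallForest.{u}).part ⟨6⟩ = (M _ smallForest.{u}).part ⟨7⟩ :=
    (hG.part_eq_of_leaf (s2.leaf_left ⟨6⟩ (by decide) (by decide))).trans
      (hG.part_eq_of_leaf (s2.leaf_left ⟨7⟩ (by decide) (by decide))).symm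
  have hle := hK _ smallForest smallForestAddEdge fun u v => ⟨fun _ h => hlt.le h, fun hn h => by
    rcases h with h | h
    · exact h
    · rw [SimpleGraph.edge_adj] at h
      rw [sameCluster_iff] at hn
      rcases h.1 with ⟨rfl, rfl⟩ | ⟨rfl, rfl⟩
      · exact absurd h67 hn
      · exact absurd h67.symm hn⟩
  obtain ⟨c, hc, hsub⟩ := hle (b := (M _ smallForestAddEdge.{u}).part ⟨1⟩) (by simp)
  have h1 : (⟨1⟩ : ULift (Fin 9)) ∈ c := hsub (by simp)
  have h2 : (⟨2⟩ : ULift (Fin 9)) ∈ c := hsub (by rw [hwhole]; simp)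
  exact hsplit (sameCluster_iff.1 ⟨c, hc, h1, h2⟩)

/-- Two double stars, one with one and three leaves and one with two and three leaves. -/
def largeForest : SimpleGraph (ULift.{u} (Fin 13)) :=
  forest ![1, 1, 1, 2, 2, 2, 6, 6, 6, 6, 9, 9, 9]

/-- `largeForest` without the middle edge of its second double starGraph. -/
def largeForestDeleteEdge : SimpleGraph (ULift.{u} (Fin 13)) :=
  largeForest.deleteEdges {s(⟨6⟩, ⟨9⟩)}

/-- The second double star is split because `5 · 7 > 2|E| = 22`, so its middle edge runs between
clusters. Removing that edge lowers `2|E|` to `20`, below the product `3 · 7` that decides whether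
the first double star is split. -/
theorem not_interEdgeConsistency {M : ClusteringMethod.{u}} (hM : IsModularityOptimisation M) :
    ¬ InterEdgeConsistency M := by
  intro hI
  have hG := hM _ largeForest.{u}
  have hH := hM _ largeForestDeleteEdge.{u}
  have s1 : IsDoubleStar largeForest.{u} (block 0 1) (block 2 5) ⟨1⟩ ⟨2⟩ := by
    unfold largeForest; decide
  have s2 : IsDoubleStar largeForest.{u} (block 6 8) (block 9 12) ⟨6⟩ ⟨9⟩ := by
    unfold largeForest; decide
  have s1' : IsDoubleStar largeForestDeleteEdge.{u} (block 0 1) (block 2 5) ⟨1⟩ ⟨2⟩ := by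
    unfold largeForestDeleteEdge largeForest; decide
  have hm : 2 * numEdges largeForest.{u} = 22 :=
    s1.two_mul_numEdges_of_pair s2 (by decide) (by decide)
  have hle : largeForestDeleteEdge.{u} ≤ largeForest := SimpleGraph.deleteEdges_le _
  have hlt : largeForestDeleteEdge.{u} < largeForest := by
    refine hle.lt_of_ne fun h => ?_
    have h69 := s2.adj
    rw [← h, largeForestDeleteEdge, SimpleGraph.deleteEdges_adj] at h69
    exact h69.2 rfl
  have hm' := numEdges_lt_of_lt hlt
  have c1 : (block 0 1 : Finset (ULift.{u} (Fin 13))).card = 2 := by decide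
  have c2 : (block 2 5 : Finset (ULift.{u} (Fin 13))).card = 4 := by decide
  have c3 : (block 6 8 : Finset (ULift.{u} (Fin 13))).card = 3 := by decide
  have c4 : (block 9 12 : Finset (ULift.{u} (Fin 13))).card = 4 := by decide
  have hwhole := s1.part_eq_of_lt hG (by rw [c1, c2]; omega)
  have hsplit := s1'.part_ne_of_lt hH (by rw [c1, c2]; omega)
  have hinter := s2.part_ne_of_lt hG (by rw [c3, c4]; omega)
  have heq := hI _ largeForest largeForestDeleteEdge ⟨hle, fun u v huv h => by
    rw [largeForestDeleteEdge, SimpleGraph.deleteEdges_adj]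
    refine ⟨h, fun he => ?_⟩
    rw [sameCluster_iff] at huv
    rcases Sym2.eq_iff.1 (Set.mem_singleton_iff.1 he) with ⟨rfl, rfl⟩ | ⟨rfl, rfl⟩
    · exact hinter huv
    · exact hinter huv.symm⟩
  rw [heq] at hsplit
  exact hsplit hwhole

end Consistency

/-! ### Stars and connectivity -/

section Connectivity

/-- The star with centre `0` and `n` leaves. -/
def starGraph (n : ℕ) : SimpleGraph (ULift.{u} (Fin (n + 1))) :=
  forest fun _ => 0

lemma starGraph_adj_leaf {n : ℕ} {v : ULift.{u} (Fin (n + 1))} (hv : v ≠ ⟨0⟩) (z) :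
    (starGraph n).Adj v z ↔ z = ⟨0⟩ := by
  have hv' : v.down ≠ 0 := fun h => hv (ULift.ext _ _ h)
  constructor
  · rintro ⟨-, h | h⟩
    · exact ULift.ext _ _ h.symm
    · exact absurd h.symm hv'
  · rintro rfl
    exact ⟨hv, Or.inl rfl⟩

lemma minEdgeCut_le {V : Type u} [Fintype V] [DecidableEq V] (G : SimpleGraph V) {S c : Finset V}
    (hS : S ⊂ c) (hne : S.Nonempty) : minEdgeCut G c ≤ cutSize G S (c \ S) :=
  Nat.sInf_le ⟨S, hS, hne, rfl⟩

/-- A star is always a single cluster, and the minimum edge cut of a star is `1`. -/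
theorem not_connectivity {M : ClusteringMethod.{u}} (hM : IsModularityOptimisation M) :
    ¬ Connectivity M := by
  classical
  rintro ⟨f, -, hf, hcut⟩
  obtain ⟨N, hN⟩ := eventually_atTop.1 (hf.eventually_ge_atTop 1)
  obtain ⟨n, hn⟩ := exists_nat_ge N
  -- one extra leaf makes sure that there is at least one
  have hG := hM _ (starGraph.{u} (n + 1))
  have huniv : (M _ (starGraph.{u} (n + 1))).part ⟨0⟩ = Finset.univ := by
    refine Finset.eq_univ_of_forall fun v => ?_
    by_cases hv : v = ⟨0⟩
    · simp [hv]
    · rw [← hG.part_eq_of_leaf (starGraph_adj_leaf hv)]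
      simp
  have hmem : Finset.univ ∈ (M _ (starGraph.{u} (n + 1))).parts := by
    have h := (M _ (starGraph.{u} (n + 1))).part_mem.2 (Finset.mem_univ ⟨0⟩)
    rwa [huniv] at h
  have hcard : (Finset.univ : Finset (ULift.{u} (Fin (n + 1 + 1)))).card = n + 2 := by simp
  have h1 := hcut _ _ _ hmem (by omega)
  have h2 : N ≤ ((n + 2 : ℕ) : ℝ≥0) := hn.trans (by exact_mod_cast Nat.le_add_right n 2)
  rw [hcard] at h1
  have h3 : 1 < minEdgeCut (starGraph.{u} (n + 1)) Finset.univ := by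
    exact_mod_cast (hN _ h2).trans_lt h1
  let v : ULift.{u} (Fin (n + 1 + 1)) := ⟨1⟩
  have hv : v ≠ ⟨0⟩ := fun h => by simpa [v] using congrArg ULift.down h
  have h4 : minEdgeCut (starGraph.{u} (n + 1)) Finset.univ ≤ 1 := by
    refine (minEdgeCut_le _ (S := {v}) ?_ (by simp)).trans ?_
    · refine Finset.ssubset_univ_iff.2 fun h => hv ?_
      have h0 : (⟨0⟩ : ULift.{u} (Fin (n + 1 + 1))) ∈ ({v} : Finset _) := by
        rw [h]
        exact Finset.mem_univ _
      exact (Finset.mem_singleton.1 h0).symm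
    · simp only [cutSize_eq_sum, Finset.sum_singleton, starGraph_adj_leaf hv]
      rw [Finset.sum_ite_eq']
      split <;> simp
  omega

end Connectivity

/-! ### Pairs of cliques -/

section PairOfCliques

/-- If both cliques of a pair are clusters of an optimal clustering, then the number of edges of the
network is bounded in terms of the size of the cliques. -/
lemma IsPairOfCliquesComponent.numEdges_le {V : Type u} [Fintype V] [DecidableEq V]
    {G : SimpleGraph V} {A B : Finset V} (h : IsPairOfCliquesComponent G A B) {P : Clustering V}
    (hP : IsModularityOptimal G P) (hA : A ∈ P.parts) (hB : B ∈ P.parts) :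
    2 * numEdges G ≤ (A.card * (2 * A.card)) ^ 2 := by
  classical
  have hdeg : ∀ c ⊆ A ∪ B, degreeSum G c ≤ c.card * (2 * A.card) := by
    intro c hc
    rw [degreeSum, ← smul_eq_mul]
    refine Finset.sum_le_card_nsmul _ _ _ fun v hv => ?_
    rw [← SimpleGraph.card_neighborFinset_eq_degree, two_mul]
    nth_rewrite 2 [h.card_eq]
    refine (Finset.card_le_card fun w hw => ?_).trans (Finset.card_union_le A B)
    exact h.closed v (hc hv) w (by simpa using hw)
  obtain ⟨⟨u, v⟩, huv⟩ := Finset.card_pos.1 (h.one_edge ▸ Nat.one_pos : 0 < cutSize G A B)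
  obtain ⟨hu, hv, huv⟩ := (SimpleGraph.mem_interedges_iff G).1 huv
  have hne : A ≠ B := by
    rintro rfl
    exact Finset.disjoint_left.1 h.disjoint hu hu
  have hle := hP.le_of_adj hA hB hne hu hv huv
  rw [h.one_edge, mul_one] at hle
  refine hle.trans ?_
  rw [sq]
  refine Nat.mul_le_mul (hdeg A Finset.subset_union_left) ?_
  have := hdeg B Finset.subset_union_right
  rwa [← h.card_eq] at this

/-- The disjoint union of `t` copies of a pair of cliques with `k + 2` vertices each; a vertex
consists of the label of the copy, the side, and the label in the clique. The two vertices labelled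
`0` carry the connecting edge, and `k + 2` ensures that no vertex is isolated. -/
def pairsOfCliques (t k : ℕ) : SimpleGraph (ULift.{u} (Fin t × Bool × Fin (k + 2))) where
  Adj p q := p.down.1 = q.down.1 ∧ (p.down.2.1 = q.down.2.1 ∧ p.down.2.2 ≠ q.down.2.2 ∨
    p.down.2.1 ≠ q.down.2.1 ∧ p.down.2.2 = 0 ∧ q.down.2.2 = 0)
  symm := ⟨fun _ _ h => ⟨h.1.symm, h.2.imp (fun h => ⟨h.1.symm, h.2.symm⟩)
    fun h => ⟨h.1.symm, h.2.2, h.2.1⟩⟩⟩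
  loopless := ⟨fun _ h => h.2.elim (fun h => h.2 rfl) fun h => h.1 rfl⟩

/-- The clique on side `s` of the copy `i` in `pairsOfCliques t k`. -/
def pairClique {t : ℕ} (k : ℕ) (i : Fin t) (s : Bool) :
    Finset (ULift.{u} (Fin t × Bool × Fin (k + 2))) :=
  Finset.univ.filter fun p => p.down.1 = i ∧ p.down.2.1 = s

lemma mem_pairClique {t k : ℕ} {i : Fin t} {s : Bool}
    {p : ULift.{u} (Fin t × Bool × Fin (k + 2))} :
    p ∈ pairClique k i s ↔ p.down.1 = i ∧ p.down.2.1 = s := by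
  simp [pairClique]

lemma card_pairClique {t : ℕ} (k : ℕ) (i : Fin t) (s : Bool) :
    (pairClique.{u} k i s).card = k + 2 := by
  have h : pairClique.{u} k i s = Finset.univ.image fun j : Fin (k + 2) => ⟨(i, s, j)⟩ := by
    ext ⟨a, b, c⟩
    simp [mem_pairClique, eq_comm]
  rw [h, Finset.card_image_of_injective]
  · simp
  · intro a b hab
    simpa using hab

lemma isPairOfCliquesComponent_pairClique {t : ℕ} (k : ℕ) (i : Fin t) :
    IsPairOfCliquesComponent (pairsOfCliques.{u} t k) (pairClique k i false)
      (pairClique k i true) where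
  disjoint := by
    rw [Finset.disjoint_left]
    intro p h1 h2
    rw [mem_pairClique] at h1 h2
    exact absurd (h1.2.symm.trans h2.2) (by decide)
  card_eq := by rw [card_pairClique, card_pairClique]
  clique_left := by
    intro p hp q hq hpq
    rw [Finset.mem_coe, mem_pairClique] at hp hq
    refine ⟨hp.1.trans hq.1.symm, Or.inl ⟨hp.2.trans hq.2.symm, fun h => hpq ?_⟩⟩
    exact ULift.ext _ _ (Prod.ext (hp.1.trans hq.1.symm) (Prod.ext (hp.2.trans hq.2.symm) h))
  clique_right := by
    intro p hp q hq hpq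
    rw [Finset.mem_coe, mem_pairClique] at hp hq
    refine ⟨hp.1.trans hq.1.symm, Or.inl ⟨hp.2.trans hq.2.symm, fun h => hpq ?_⟩⟩
    exact ULift.ext _ _ (Prod.ext (hp.1.trans hq.1.symm) (Prod.ext (hp.2.trans hq.2.symm) h))
  one_edge := by
    classical
    rw [cutSize, Finset.card_eq_one]
    refine ⟨(⟨(i, false, 0)⟩, ⟨(i, true, 0)⟩), ?_⟩
    ext ⟨⟨a, b, c⟩, ⟨a', b', c'⟩⟩
    rw [SimpleGraph.mem_interedges_iff, Finset.mem_singleton, mem_pairClique, mem_pairClique]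
    simp only [pairsOfCliques, Prod.mk.injEq, ULift.up_inj]
    constructor
    · rintro ⟨⟨rfl, rfl⟩, ⟨rfl, rfl⟩, -, h | h⟩
      · exact absurd h.1 (by decide)
      · exact ⟨⟨rfl, rfl, h.2.1⟩, rfl, rfl, h.2.2⟩
    · rintro ⟨⟨rfl, rfl, rfl⟩, rfl, rfl, rfl⟩
      simp
  closed := by
    intro p hp q hpq
    have hp' : p.down.1 = i := by
      rcases Finset.mem_union.1 hp with h | h <;> exact (mem_pairClique.1 h).1
    rw [Finset.mem_union, mem_pairClique, mem_pairClique, ← hpq.1, hp']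
    cases q.down.2.1 <;> simp

lemma card_le_two_mul_numEdges_pairsOfCliques (t k : ℕ) :
    t ≤ 2 * numEdges (pairsOfCliques.{u} t k) := by
  classical
  rw [← degreeSum_univ, degreeSum]
  have h : ∀ v ∈ Finset.univ, 1 ≤ (pairsOfCliques.{u} t k).degree v := by
    rintro ⟨i, s, j⟩ -
    rw [Nat.one_le_iff_ne_zero, ← Nat.pos_iff_ne_zero, SimpleGraph.degree_pos_iff_exists_adj]
    obtain ⟨j', hj'⟩ := exists_ne j
    exact ⟨⟨(i, s, j')⟩, rfl, Or.inl ⟨rfl, hj'.symm⟩⟩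
  refine le_trans ?_ (Finset.card_nsmul_le_sum _ _ 1 h)
  simp only [Finset.card_univ, Fintype.card_ulift, Fintype.card_prod, Fintype.card_fin,
    Fintype.card_bool, smul_eq_mul, mul_one]
  exact Nat.le_mul_of_pos_right _ (by positivity)

/-- A network with sufficiently many copies of a pair of cliques has too many edges for the two
cliques of a pair to be separate clusters. -/
theorem not_pairOfCliques {M : ClusteringMethod.{u}} (hM : IsModularityOptimisation M) :
    ¬ PairOfCliques M := by
  rintro ⟨n, hn⟩
  let t := ((n + 2) * (2 * (n + 2))) ^ 2 + 1
  have hpair := isPairOfCliquesComponent_pairClique.{u} (t := t) n 0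
  have hparts := hn _ _ _ _ hpair (by
    refine le_trans ?_ (Finset.card_le_card Finset.subset_union_left)
    rw [card_pairClique]
    omega)
  have h1 := hpair.numEdges_le (hM _ _) hparts.1 hparts.2
  have h2 := card_le_two_mul_numEdges_pairsOfCliques.{u} t n
  rw [card_pairClique] at h1
  exact absurd (h2.trans h1) (by simp [t])

end PairOfCliques

/-! ### Fixed points and the resolution limit -/

section FixedPoint

/-- Two disjoint paths with four vertices. -/
def twoPaths : SimpleGraph (ULift.{u} (Fin 8)) :=
  forest ![1, 1, 1, 2, 5, 5, 5, 6]

/-- The vertices of the first path of `twoPaths`. -/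
abbrev firstPath : Finset (ULift.{u} (Fin 8)) :=
  block 0 1 ∪ block 2 3

lemma isDoubleStar_twoPaths : IsDoubleStar twoPaths.{u} (block 0 1) (block 2 3) ⟨1⟩ ⟨2⟩ := by
  unfold twoPaths; decide

/-- The first path is a cluster of every optimal clustering, as `3 · 3 < 2|E| = 12`. -/
lemma IsModularityOptimal.mem_parts_twoPaths {P : Clustering (ULift.{u} (Fin 8))}
    (hP : IsModularityOptimal twoPaths P) : firstPath ∈ P.parts := by
  have s := isDoubleStar_twoPaths.{u}
  have s' : IsDoubleStar twoPaths.{u} (block 4 5) (block 6 7) ⟨5⟩ ⟨6⟩ := by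
    unfold twoPaths; decide
  have hm : 2 * numEdges twoPaths.{u} = 12 := s.two_mul_numEdges_of_pair s' (by decide) (by decide)
  have c1 : (block 0 1 : Finset (ULift.{u} (Fin 8))).card = 2 := by decide
  have c2 : (block 2 3 : Finset (ULift.{u} (Fin 8))).card = 2 := by decide
  have h := P.part_mem.2 (Finset.mem_univ ⟨1⟩)
  rwa [s.part_eq_union hP (s.part_eq_of_lt hP (by rw [c1, c2]; omega))] at h

/-- On its own, the first path is not a cluster of any optimal clustering, as
`3 · 3 > 2|E| = 6`. -/
lemma clustersIn_ne_of_isModularityOptimal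
    {Q : Clustering {v // v ∈ Finset.sup {firstPath.{u}} id}}
    (hQ : IsModularityOptimal (inducedOnUnion twoPaths {firstPath}) Q) :
    clustersIn Q ≠ {firstPath} := by
  intro h
  have s := isDoubleStar_twoPaths.{u}.induce
    (W := Finset.sup {firstPath.{u}} id)
    (by decide) (by decide)
  have huniv : Finset.univ = (block 0 1).subtype (· ∈ Finset.sup {firstPath.{u}} id) ∪
      (block 2 3).subtype _ := by
    ext ⟨v, hv⟩
    simpa using hv
  have c1 : ((block 0 1).subtype (· ∈ Finset.sup {firstPath.{u}} id)).card = 2 := by decide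
  have c2 : ((block 2 3).subtype (· ∈ Finset.sup {firstPath.{u}} id)).card = 2 := by decide
  have hm := s.two_mul_numEdges huniv
  have hne := s.part_ne_of_lt hQ (by rw [hm, c1, c2]; decide)
  -- all clusters of `Q` have the same image, hence there is only one
  have himg : ∀ x, (Q.part x).image Subtype.val = firstPath := by
    intro x
    refine Finset.mem_singleton.1 (h.subset ?_)
    exact Finset.mem_image_of_mem _ (Q.part_mem.2 (Finset.mem_univ _))
  exact hne (Finset.image_injective Subtype.val_injective ((himg _).trans (himg _).symm))

theorem not_fixedPoint {M : ClusteringMethod.{u}} (hM : IsModularityOptimisation M) :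
    ¬ FixedPoint M := fun h =>
  clustersIn_ne_of_isModularityOptimal (hM _ _) (h _ twoPaths {firstPath}
    (Finset.singleton_subset_iff.2 (hM _ twoPaths).mem_parts_twoPaths))

theorem not_modularityResolutionLimitFree : ¬ ModularityResolutionLimitFree.{u} := by
  intro h
  obtain ⟨M, hM⟩ := exists_isModularityOptimisation.{u}
  -- the first path as a single cluster
  have hne : (Finset.univ : Finset {v // v ∈ Finset.sup {firstPath.{u}} id}) ≠ ∅ := by decide
  have hQ : clustersIn (Finpartition.indiscrete hne) = {firstPath} := by
    rw [clustersIn, Finpartition.indiscrete_parts, Finset.image_singleton]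
    congr 1
  exact clustersIn_ne_of_isModularityOptimal (h _ twoPaths _ (hM _ twoPaths)
    {firstPath} (Finset.singleton_subset_iff.2 (hM _ twoPaths).mem_parts_twoPaths)
    _ hQ) hQ

end FixedPoint

end GraphClustering

theorem mainTheorem2 :
    (∀ M : GraphClustering.ClusteringMethod.{u}, GraphClustering.IsModularityOptimisation M →
      GraphClustering.Richness M ∧
      ¬ GraphClustering.StandardConsistency M ∧
      ¬ GraphClustering.RefinementConsistency M ∧
      ¬ GraphClustering.KleinbergRefinementConsistency M ∧
      ¬ GraphClustering.InterEdgeConsistency M ∧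
      ¬ GraphClustering.Connectivity M ∧
      ¬ GraphClustering.PairOfCliques M ∧
      ¬ GraphClustering.FixedPoint M) ∧
    ¬ GraphClustering.ModularityResolutionLimitFree.{u} := by
  refine ⟨fun M hM => ?_, GraphClustering.not_modularityResolutionLimitFree⟩
  have hK := GraphClustering.not_kleinbergRefinementConsistency hM
  exact ⟨GraphClustering.richness hM, fun h => hK h.kleinberg, fun h => hK h.kleinberg, hK,
    GraphClustering.not_interEdgeConsistency hM, GraphClustering.not_connectivity hM,
    GraphClustering.not_pairOfCliques hM, GraphClustering.not_fixedPoint hM⟩
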